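/- Let $d\ge 1$, let $a_1,\dots,a_d>0$, let $\mathcal A_1,\dots,\mathcal A_d$ be measurable spaces, and for $1\le i\le d$ let $R^{(i)}=R^{(i)}_{X_1\dots X_i}$ be a probability measure on $\mathcal A_1\times\dots\times\mathcal A_i$. For probability measures $P,Q$ on the same space that are not mutually singular, with densities $p,q$ with respect to a common dominating measure $\nu$, and for $\lambda\in(0,1)$, the tilted distribution $(P,Q)_\lambda$ is the probability measure whose $\nu$-density is $p^{\lambda}q^{1-\lambda}\big/\int p^{\lambda}q^{1-\lambda}\,d\nu$; it is not defined if $P\perp Q$. Let $D(\cdot\|\cdot)\in[0,\infty]$ denote relative entropy. The Marginalize-Tilt algorithm with input $(a_i,R^{(i)})_{i\le d}$ sets $S^{(d)}=R^{(d)}$ and, for $k=d-1,\dots,1$, $$S^{(k)}_{X_1\dots X_k}=\Big(R^{(k)}_{X_1\dots X_k},\,S^{(k+1)}_{X_1\dots X_k}\Big)_{\frac{a_k}{a_k+\dots+a_d}},$$ where $S^{(k+1)}_{X_1\dots X_k}$ is the marginal of $S^{(k+1)}$ on the first $k$ components, and it outputs $$P^\star_{X_1\dots X_d}=S^{(1)}_{X_1}\,S^{(2)}_{X_2|X_1}\cdots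 S^{(d)}_{X_d|X_1\dots X_{d-1}},$$ where $S^{(k)}_{X_k|X_1\dots X_{k-1}}$ is any version of the regular conditional distribution under $S^{(k)}$. (i) Suppose that all tilted distributions formed by the algorithm are defined, i.e. $R^{(k)}\not\perp S^{(k+1)}_{X_1\dots X_k}$ for all $1\le k<d$. Then every output $P^\star$ of the algorithm is a probability measure and is the unique minimizer, over all probability measures $P$ on $\mathcal A_1\times\dots\times\mathcal A_d$, of $$\sum_{i=1}^d a_i\,D\big(P_{X_1\dots X_i}\,\big\|\,R^{(i)}_{X_1\dots X_i}\big).$$ An output exists whenever $\mathcal A_2,\dots,\mathcal A_d$ are standard Borel spaces. (ii) (Multi-scale Gibbs posterior.) Let $\mathcal W=\mathcal A_1\times\dots\times\mathcal A_d$, let $\mathsf Z$ be a set, and let $\ell:\mathcal W\times\mathsf Z\to[0,\infty)$ be a loss, measurable in its first argument. For a training sample $s=(z_1,\dots,z_n)\in\mathsf Z^n$ let $L_s(w)=\frac1n\sum_{i=1}^n\ell(w,z_i)$, and for $1\le i\le d$ let the prior $Q^{(i)}$ be a probability measure on $\mathcal A_1\times\dots\times\mathcal A_i$. Run the algorithm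 with $R^{(i)}=Q^{(i)}$ for $i<d$ and $$R^{(d)}(dw)=\frac{e^{-L_s(w)/a_d}\,Q^{(d)}(dw)}{\int e^{-L_s(v)/a_d}\,Q^{(d)}(dv)} ,$$ and suppose that all tilted distributions it forms are defined. Then every output $P^\star$ is a probability measure and is the unique minimizer, over all probability measures $P$ on $\mathcal W$, of $$\int L_s\,dP+\sum_{i=1}^d a_i\,D\big(P_{W_1\dots W_i}\,\big\|\,Q^{(i)}_{W_1\dots W_i}\big).$$ -/

import Mathlib

open MeasureTheory ProbabilityTheory InformationTheory Finset
open scoped ENNReal NNReal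

namespace MarginalizeTilt

/-- The prefix space of the components with index at most `k`. Components are numbered from `0`, so
`Pre X k` carries the joint law of the first `k + 1` components. -/
abbrev Pre (X : ℕ → Type*) (k : ℕ) : Type _ := (i : Iic k) → X i

section Tilt

variable {A : Type*} [MeasurableSpace A]

/-- The unnormalised geometric mixture of `P` and `Q`: with respect to the dominating measure
`P + Q` its density is `p ^ t * q ^ (1 - t)`, where `p` and `q` are the densities of `P` and `Q`.
(For `0 < t < 1` the measure does not depend on the dominating measure that is used.) -/
noncomputable def geometricMixture (P Q : Measure A) (t : ℝ) : Measure A :=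
  (P + Q).withDensity fun x =>
    (P.rnDeriv (P + Q) x) ^ t * (Q.rnDeriv (P + Q) x) ^ (1 - t)

/-- The tilted distribution `(P, Q)_t`: the geometric mixture normalised to total mass one. The
normalising factor is `exp ((1 - t) * D_t(P‖Q))`, where `D_t` is the Rényi divergence of order `t`.
For `0 < t < 1` it is meaningful exactly when `P` and `Q` are not mutually singular. -/
noncomputable def tiltedDist (P Q : Measure A) (t : ℝ) : Measure A :=
  (geometricMixture P Q t Set.univ)⁻¹ • geometricMixture P Q t

/-- `P` is a probability measure, and it has a strictly smaller value of `F` than every other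
probability measure. -/
def IsUniqueMinimizer (F : Measure A → ℝ≥0∞) (P : Measure A) : Prop :=
  IsProbabilityMeasure P ∧
    ∀ P' : Measure A, IsProbabilityMeasure P' → P' ≠ P → F P < F P'

end Tilt

section Algorithm

variable {X : ℕ → Type*} [∀ k, MeasurableSpace (X k)]

/-- The marginal of a law on the components `0, …, l` on the components `0, …, k`. -/
noncomputable def marginal {k l : ℕ} (h : k ≤ l) (P : Measure (Pre X l)) : Measure (Pre X k) :=
  P.map (Preorder.frestrictLe₂ h)

/-- The order `a_k / (a_k + … + a_m)` of the tilting step at level `k`. -/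
noncomputable def tiltOrder (m : ℕ) (a : ℕ → ℝ) (k : ℕ) : ℝ :=
  a k / ∑ i ∈ Icc k m, a i

/-- The intermediate distributions `S^(k)` of the algorithm on `m + 1` components, computed
backwards from `S^(m) = R^(m)` by marginalizing `S^(k+1)` and then tilting with `R^(k)`. -/
noncomputable def mtStage (m : ℕ) (a : ℕ → ℝ) (R : (k : ℕ) → Measure (Pre X k)) (k : ℕ) :
    Measure (Pre X k) :=
  if k < m then
    tiltedDist (R k) (marginal (Nat.le_succ k) (mtStage m a R (k + 1))) (tiltOrder m a k)
  else R k
termination_by m - k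

/-- Every tilted distribution that the algorithm forms is defined: its two arguments are not
mutually singular. -/
def MTDefined (m : ℕ) (a : ℕ → ℝ) (R : (k : ℕ) → Measure (Pre X k)) : Prop :=
  ∀ k < m, ¬ (R k) ⟂ₘ (marginal (Nat.le_succ k) (mtStage m a R (k + 1)))

/-- Splits off the last component. -/
def splitLast (k : ℕ) (x : Pre X (k + 1)) : Pre X k × X (k + 1) :=
  (Preorder.frestrictLe₂ (Nat.le_succ k) x, x ⟨k + 1, mem_Iic.2 le_rfl⟩)

/-- Appends a last component. -/
def appendLast (k : ℕ) (p : Pre X k × X (k + 1)) : Pre X (k + 1) :=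
  IicProdIoc k (k + 1) (p.1, MeasurableEquiv.piSingleton k p.2)

/-- The joint law of the components `0, …, k` when the first has law `μ` and, for each `i`, the law
of component `i + 1` given the preceding ones is the kernel `κ i`. -/
noncomputable def productOfConditionals (μ : Measure (Pre X 0))
    (κ : (k : ℕ) → Kernel (Pre X k) (X (k + 1))) : (k : ℕ) → Measure (Pre X k)
  | 0 => μ
  | k + 1 => ((productOfConditionals μ κ k) ⊗ₘ (κ k)).map (appendLast k)

/-- `P` is an output of the Marginalize-Tilt algorithm: the product of the law `S^(0)` and of
(versions of) the conditional distributions of the last component of `S^(k+1)` given the others. -/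
def IsMTOutput (m : ℕ) (a : ℕ → ℝ) (R : (k : ℕ) → Measure (Pre X k))
    (P : Measure (Pre X m)) : Prop :=
  ∃ κ : (k : ℕ) → Kernel (Pre X k) (X (k + 1)),
    (∀ k < m, IsMarkovKernel (κ k) ∧
      ((mtStage m a R (k + 1)).map (splitLast k)).IsCondKernel (κ k)) ∧
    P = productOfConditionals (mtStage m a R 0) κ m

/-- The sum over `k` of `a_k` times the relative entropy of the marginal of `P` on the components
`0, …, k` with respect to `R^(k)`. -/
noncomputable def entropySum (m : ℕ) (a : ℕ → ℝ) (R : (k : ℕ) → Measure (Pre X k))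
    (P : Measure (Pre X m)) : ℝ≥0∞ :=
  ∑ k : Fin (m + 1),
    ENNReal.ofReal (a k) * klDiv (marginal (Nat.le_of_lt_succ k.isLt) P) (R k)

end Algorithm

section Gibbs

variable {X : ℕ → Type*} [∀ k, MeasurableSpace (X k)] {Z : Type*}

/-- The empirical risk of the hypothesis `w` on the training sample `s`. -/
noncomputable def empiricalRisk {m n : ℕ} (loss : Pre X m → Z → ℝ≥0) (s : Fin n → Z)
    (w : Pre X m) : ℝ≥0 :=
  (n : ℝ≥0)⁻¹ * ∑ i, loss w (s i)

/-- The priors `Q`, with the last one replaced by its Gibbs tilt, whose density with respect to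
`Q^(m)` is proportional to `exp (-(empirical risk) / a_m)`. -/
noncomputable def gibbsInput {n : ℕ} (m : ℕ) (a : ℕ → ℝ) (loss : Pre X m → Z → ℝ≥0)
    (s : Fin n → Z) (Q : (k : ℕ) → Measure (Pre X k)) : (k : ℕ) → Measure (Pre X k) :=
  Function.update Q m ((Q m).tilted fun w => -(empiricalRisk loss s w : ℝ) / a m)

/-- The expected empirical risk with multilevel entropic regularization. -/
noncomputable def regularizedRisk {n : ℕ} (m : ℕ) (a : ℕ → ℝ) (loss : Pre X m → Z → ℝ≥0)
    (s : Fin n → Z) (Q : (k : ℕ) → Measure (Pre X k)) (P : Measure (Pre X m)) : ℝ≥0∞ :=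
  (∫⁻ w, (empiricalRisk loss s w : ℝ≥0∞) ∂P) + entropySum m a Q P

end Gibbs

end MarginalizeTilt

open MarginalizeTilt

/-!
The objective is rewritten as a finite constant plus weighted relative entropies, which vanish
simultaneously only at the output. Write `P_k` for the marginal of `P` on the components `0, …, k`,
`S_k` for the stages of the algorithm, `κ_k` for the conditional distributions of the stages and
`A_k = a_k + … + a_m`. Two identities in `[0, ∞]` are applied backwards from the last level.

* The chain rule `klDiv_compProd_eq_fst_add` splits `D(P_{k+1} ‖ S_{k+1})` into the relative entropy
  of `P_k` with respect to the marginal of `S_{k+1}` and a conditional term, which is the divergence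
  of `P_{k+1}` from `P_k ⊗ₘ κ_k`. The components are arbitrary measurable spaces, so `P` need not
  have conditional distributions; in this form of the chain rule only those of `S_{k+1}` occur.
* The tilting identity `exists_add_klDiv_eq_klDiv_tiltedDist` merges
  `a_k D(P_k ‖ R_k) + A_{k+1} D(P_k ‖ marginal of S_{k+1})` into `A_k D(P_k ‖ S_k)` plus a constant,
  which is finite exactly because the two distributions are not mutually singular.

Together (`exists_sum_klDiv_eq`) they give
`∑ a_k D(P_k ‖ R_k) = A_0 D(P_0 ‖ S_0) + ∑ A_{k+1} D(P_{k+1} ‖ P_k ⊗ₘ κ_k) + C` with `C < ∞`.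
The output makes every divergence on the right zero. Nothing else does, because a divergence
vanishes only between equal laws.

For the Gibbs posterior, the expected loss is absorbed into the last entropy term
(`exists_regularizedRisk_eq`), which changes the objective by a finite constant.

All these identities come from pointwise identities between log-likelihood ratios. These may fail to
be integrable, but they are bounded below by integrable functions, which is enough for their
expectations in `(-∞, ∞]` to be additive (`HasNonnegMean.extExp_add`). Hence infinite terms need no
separate treatment, apart from failures of absolute continuity.
-/

namespace MarginalizeTilt

/-! ### Extended expectations -/

section ExtendedExpectation

variable {A : Type*} [MeasurableSpace A] {P : Measure A} {f g h : A → ℝ} {α β : ℝ}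

open scoped Classical in
/-- The expectation of a function of nonnegative mean, with value `∞` where it is not integrable. -/
noncomputable def extExp (P : Measure A) (f : A → ℝ) : ℝ≥0∞ :=
  if Integrable f P then ENNReal.ofReal (∫ x, f x ∂P) else ∞

/-- `f` has an integrable lower bound, and a nonnegative mean if it is integrable (otherwise its
Bochner integral is `0`). Log-likelihood ratios of probability measures have this property. It makes
`extExp P` additive although neither summand need be integrable. -/
structure HasNonnegMean (P : Measure A) (f : A → ℝ) : Prop where
  aestronglyMeasurable : AEStronglyMeasurable f P
  exists_le : ∃ u : A → ℝ, Integrable u P ∧ u ≤ᵐ[P] f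
  integral_nonneg : 0 ≤ ∫ x, f x ∂P

lemma extExp_congr (hfg : f =ᵐ[P] g) : extExp P f = extExp P g := by
  unfold extExp
  rw [integral_congr_ae hfg]
  congr 1
  exact propext (integrable_congr hfg)

lemma HasNonnegMean.of_nonneg (hf : AEStronglyMeasurable f P) (h0 : ∀ x, 0 ≤ f x) :
    HasNonnegMean P f :=
  ⟨hf, ⟨fun _ => 0, integrable_zero _ _ _, .of_forall h0⟩, MeasureTheory.integral_nonneg h0⟩

lemma extExp_const [IsProbabilityMeasure P] (c : ℝ) :
    extExp P (fun _ => c) = ENNReal.ofReal c := by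
  simp [extExp]

lemma extExp_eq_lintegral (hf : AEStronglyMeasurable f P) (h0 : ∀ x, 0 ≤ f x) :
    extExp P f = ∫⁻ x, ENNReal.ofReal (f x) ∂P := by
  unfold extExp
  split_ifs with hi
  · exact ofReal_integral_eq_lintegral_ofReal hi (.of_forall h0)
  · by_contra hne
    exact hi ((lintegral_ofReal_ne_top_iff_integrable hf (.of_forall h0)).1 (Ne.symm hne))

/-- Subtracting the integrable lower bounds makes both summands nonnegative, so that each is
dominated by their sum. -/
lemma HasNonnegMean.integrable_add_iff (hf : HasNonnegMean P f) (hg : HasNonnegMean P g)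
    (hα : 0 < α) (hβ : 0 < β) :
    Integrable (fun x => α * f x + β * g x) P ↔ Integrable f P ∧ Integrable g P := by
  refine ⟨fun h => ?_, fun h => (h.1.const_mul α).add (h.2.const_mul β)⟩
  obtain ⟨u, hu, huf⟩ := hf.exists_le
  obtain ⟨v, hv, hvg⟩ := hg.exists_le
  have key : Integrable (fun x => α * (f x - u x) + β * (g x - v x)) P := by
    refine (h.sub ((hu.const_mul α).add (hv.const_mul β))).congr (.of_forall fun x => ?_)
    simp only [Pi.sub_apply, Pi.add_apply]
    ring
  have h1 : Integrable (fun x => α * (f x - u x)) P := by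
    refine key.mono' ((hf.aestronglyMeasurable.sub hu.1).const_mul α) ?_
    filter_upwards [huf, hvg] with x hx hy
    have := mul_nonneg hα.le (sub_nonneg.2 hx)
    have := mul_nonneg hβ.le (sub_nonneg.2 hy)
    rw [Real.norm_of_nonneg] <;> linarith
  have h2 : Integrable (fun x => β * (g x - v x)) P := by
    refine key.mono' ((hg.aestronglyMeasurable.sub hv.1).const_mul β) ?_
    filter_upwards [huf, hvg] with x hx hy
    have := mul_nonneg hα.le (sub_nonneg.2 hx)
    have := mul_nonneg hβ.le (sub_nonneg.2 hy)
    rw [Real.norm_of_nonneg] <;> linarith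
  constructor
  · refine ((h1.const_mul α⁻¹).add hu).congr (.of_forall fun x => ?_)
    simp only [Pi.add_apply]
    field_simp
    ring
  · refine ((h2.const_mul β⁻¹).add hv).congr (.of_forall fun x => ?_)
    simp only [Pi.add_apply]
    field_simp
    ring

open scoped Classical in
lemma HasNonnegMean.extExp_add (hf : HasNonnegMean P f) (hg : HasNonnegMean P g)
    (hα : 0 < α) (hβ : 0 < β) (hh : h =ᵐ[P] fun x => α * f x + β * g x) :
    extExp P h = ENNReal.ofReal α * extExp P f + ENNReal.ofReal β * extExp P g := by
  have hα' : ENNReal.ofReal α ≠ 0 := by simpa using hα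
  have hβ' : ENNReal.ofReal β ≠ 0 := by simpa using hβ
  rw [extExp_congr hh]
  unfold extExp
  rw [if_congr (hf.integrable_add_iff hg hα hβ) rfl rfl]
  by_cases hfi : Integrable f P
  · by_cases hgi : Integrable g P
    · rw [if_pos ⟨hfi, hgi⟩, if_pos hfi, if_pos hgi,
        integral_add (hfi.const_mul α) (hgi.const_mul β), integral_const_mul, integral_const_mul,
        ENNReal.ofReal_add (mul_nonneg hα.le hf.integral_nonneg)
          (mul_nonneg hβ.le hg.integral_nonneg),
        ENNReal.ofReal_mul hα.le, ENNReal.ofReal_mul hβ.le]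
    · rw [if_neg (fun h => hgi h.2), if_neg hgi, ENNReal.mul_top hβ', add_top]
  · rw [if_neg (fun h => hfi h.1), if_neg hfi, ENNReal.mul_top hα', top_add]

end ExtendedExpectation

/-! ### Log-likelihood ratios -/

section LogLikelihood

variable {A : Type*} [MeasurableSpace A] {P Q N : Measure A}

lemma hasNonnegMean_llr [IsProbabilityMeasure P] [IsProbabilityMeasure Q] (hPQ : P ≪ Q) :
    HasNonnegMean P (llr P Q) := by
  refine ⟨(measurable_llr P Q).aestronglyMeasurable,
    ⟨fun x => -(Q.rnDeriv P x).toReal, Measure.integrable_toReal_rnDeriv.neg, ?_⟩, ?_⟩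
  · -- `-log (dP/dQ) ≤ exp (-log (dP/dQ)) = dQ/dP`
    filter_upwards [exp_neg_llr hPQ] with x hx
    rw [← hx]
    linarith [Real.add_one_le_exp (-llr P Q x)]
  · by_cases hi : Integrable (llr P Q) P
    · simpa using integral_llr_add_sub_measure_univ_nonneg hPQ hi
    · rw [integral_undef hi]

lemma klDiv_eq_extExp [IsProbabilityMeasure P] [IsProbabilityMeasure Q] (hPQ : P ≪ Q) :
    klDiv P Q = extExp P (llr P Q) := by
  unfold extExp
  split_ifs with hi
  · simp [klDiv_of_ac_of_integrable hPQ hi]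
  · exact klDiv_of_not_integrable hi

lemma llr_eq_add [SigmaFinite P] [SigmaFinite Q] [SigmaFinite N] (hPQ : P ≪ Q) (hQN : Q ≪ N) :
    llr P N =ᵐ[P] fun x => llr P Q x + llr Q N x := by
  have hPN := hPQ.trans hQN
  filter_upwards [hPN.ae_le (Measure.rnDeriv_mul_rnDeriv (κ := N) hPQ), Measure.rnDeriv_pos hPQ,
    hPQ.ae_le (Measure.rnDeriv_pos hQN), hPQ.ae_le (Measure.rnDeriv_lt_top P Q),
    hPN.ae_le (Measure.rnDeriv_lt_top Q N)] with x h1 h2 h3 h4 h5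
  simp only [llr, ← h1, Pi.mul_apply, ENNReal.toReal_mul]
  exact Real.log_mul (ENNReal.toReal_pos h2.ne' h4.ne).ne' (ENNReal.toReal_pos h3.ne' h5.ne).ne'

/-- `N` only serves as a reference measure for the density of `Q`. -/
lemma absolutelyContinuous_of_rnDeriv_pos [SigmaFinite Q] [SigmaFinite N] (hPN : P ≪ N)
    (hpos : ∀ᵐ x ∂P, 0 < Q.rnDeriv N x) : P ≪ Q := by
  refine Measure.AbsolutelyContinuous.mk fun s hs h0 => ?_
  have h1 : ∫⁻ x in s, Q.rnDeriv N x ∂N = 0 :=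
    le_antisymm ((Measure.setLIntegral_rnDeriv_le s).trans h0.le) zero_le
  rw [setLIntegral_eq_zero_iff hs (Measure.measurable_rnDeriv _ _)] at h1
  rw [← compl_compl s, ← mem_ae_iff]
  filter_upwards [hPN.ae_le h1, hpos] with x hx hp hxs
  exact hp.ne' (hx hxs)

end LogLikelihood

/-! ### The chain rule -/

section ChainRule

variable {A B : Type*} [MeasurableSpace A] [MeasurableSpace B]

lemma extExp_comp_fst {P : Measure (A × B)} {f : A → ℝ} (hf : Measurable f) :
    extExp P (fun x => f x.1) = extExp P.fst f := by
  unfold extExp Measure.fst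
  rw [integral_map measurable_fst.aemeasurable hf.aestronglyMeasurable,
    integrable_map_measure hf.aestronglyMeasurable measurable_fst.aemeasurable]
  rfl

lemma HasNonnegMean.comp_fst {P : Measure (A × B)} {f : A → ℝ} (hf : Measurable f)
    (h : HasNonnegMean P.fst f) : HasNonnegMean P (fun x => f x.1) := by
  obtain ⟨u, hu, huf⟩ := h.exists_le
  refine ⟨(hf.comp measurable_fst).aestronglyMeasurable,
    ⟨u ∘ Prod.fst, hu.comp_measurable measurable_fst,
      ae_of_ae_map measurable_fst.aemeasurable huf⟩, ?_⟩
  have := h.integral_nonneg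
  rwa [Measure.fst, integral_map measurable_fst.aemeasurable hf.aestronglyMeasurable] at this

/-- The chain rule for relative entropy, for a law `P` that need not have a conditional
distribution: the conditional relative entropy is that of `P` with respect to `P.fst ⊗ₘ κ`. -/
lemma klDiv_compProd_eq_fst_add (P : Measure (A × B)) [IsProbabilityMeasure P] (μ : Measure A)
    [IsProbabilityMeasure μ] (κ : Kernel A B) [IsMarkovKernel κ] :
    klDiv P (μ ⊗ₘ κ) = klDiv P.fst μ + klDiv P (P.fst ⊗ₘ κ) := by
  by_cases hac : P ≪ μ ⊗ₘ κ
  · have hfst : P.fst ≪ μ := by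
      have := hac.map measurable_fst
      rwa [← Measure.fst, ← Measure.fst, Measure.fst_compProd] at this
    have hrn := rnDeriv_measure_compProd_left P.fst μ κ
    -- `P.fst ⊗ₘ κ` has density `d(P.fst)/dμ` at the first component, which is positive `P`-a.e.
    have hcond : P ≪ P.fst ⊗ₘ κ := by
      refine absolutelyContinuous_of_rnDeriv_pos hac ?_
      filter_upwards [hac.ae_le hrn,
        ae_of_ae_map measurable_fst.aemeasurable (Measure.rnDeriv_pos hfst)] with x hx hp
      rwa [hx]
    have hcomp : P.fst ⊗ₘ κ ≪ μ ⊗ₘ κ := hfst.compProd_left κ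
    rw [klDiv_eq_extExp hac, klDiv_eq_extExp hfst, klDiv_eq_extExp hcond,
      ← extExp_comp_fst (measurable_llr _ _)]
    have key := ((hasNonnegMean_llr hfst).comp_fst (measurable_llr _ _)).extExp_add
      (hasNonnegMean_llr hcond) one_pos one_pos (h := llr P (μ ⊗ₘ κ)) (by
        filter_upwards [llr_eq_add hcond hcomp, hac.ae_le hrn] with x hx hr
        rw [hx]
        simp only [llr, hr]
        ring)
    simpa using key
  · -- finiteness of both terms on the right would force `P ≪ P.fst ⊗ₘ κ ≪ μ ⊗ₘ κ`
    rw [klDiv_of_not_ac hac, eq_comm, ENNReal.add_eq_top]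
    by_contra! hne
    exact hac ((klDiv_ne_top_iff.1 hne.2).1.trans ((klDiv_ne_top_iff.1 hne.1).1.compProd_left κ))

lemma klDiv_map_measurableEquiv (P Q : Measure A) [IsFiniteMeasure P] [IsFiniteMeasure Q]
    (e : A ≃ᵐ B) : klDiv (P.map e) (Q.map e) = klDiv P Q := by
  refine le_antisymm (klDiv_map_le _ _ e.measurable) ?_
  simpa using klDiv_map_le (P.map e) (Q.map e) e.symm.measurable

end ChainRule

/-! ### Tilted distributions -/

section Tilt

variable {A : Type*} [MeasurableSpace A] {P₁ P₂ : Measure A} {t : ℝ}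

lemma ac_add_left (P₁ P₂ : Measure A) : P₁ ≪ P₁ + P₂ := .add_right .rfl P₂

lemma ac_add_right (P₁ P₂ : Measure A) : P₂ ≪ P₁ + P₂ := add_comm P₂ P₁ ▸ .add_right .rfl P₁

lemma rpow_mul_rpow_eq_zero_iff {x y : ℝ≥0∞} (h0 : 0 < t) (h1 : t < 1) :
    x ^ t * y ^ (1 - t) = 0 ↔ x = 0 ∨ y = 0 := by
  rw [mul_eq_zero, ENNReal.rpow_eq_zero_iff_of_pos h0,
    ENNReal.rpow_eq_zero_iff_of_pos (sub_pos.2 h1)]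

lemma measurable_geometricMixture_density (P₁ P₂ : Measure A) (t : ℝ) :
    Measurable fun x => (P₁.rnDeriv (P₁ + P₂) x) ^ t * (P₂.rnDeriv (P₁ + P₂) x) ^ (1 - t) :=
  ((Measure.measurable_rnDeriv _ _).pow_const t).mul
    ((Measure.measurable_rnDeriv _ _).pow_const (1 - t))

/-- By Hölder's inequality, since `P₁` and `P₂` have total mass one. -/
lemma geometricMixture_univ_le_one [IsProbabilityMeasure P₁] [IsProbabilityMeasure P₂]
    (h0 : 0 < t) (h1 : t < 1) : geometricMixture P₁ P₂ t Set.univ ≤ 1 := by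
  rw [geometricMixture, withDensity_apply _ .univ, setLIntegral_univ]
  refine (ENNReal.lintegral_mul_norm_pow_le (Measure.measurable_rnDeriv _ _).aemeasurable
    (Measure.measurable_rnDeriv _ _).aemeasurable h0.le (sub_pos.2 h1).le (by ring)).trans ?_
  simp [Measure.lintegral_rnDeriv (ac_add_left P₁ P₂),
    Measure.lintegral_rnDeriv (ac_add_right P₁ P₂)]

/-- If the geometric mixture vanishes, the zero set of `dP₁/d(P₁ + P₂)` separates `P₁` from `P₂`. -/
lemma geometricMixture_univ_ne_zero [IsProbabilityMeasure P₁] [IsProbabilityMeasure P₂]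
    (h0 : 0 < t) (h1 : t < 1) (hs : ¬ P₁ ⟂ₘ P₂) : geometricMixture P₁ P₂ t Set.univ ≠ 0 := by
  intro hz
  rw [geometricMixture, withDensity_apply _ .univ, setLIntegral_univ,
    lintegral_eq_zero_iff (measurable_geometricMixture_density P₁ P₂ t)] at hz
  have hz' : ∀ᵐ x ∂(P₁ + P₂), P₁.rnDeriv (P₁ + P₂) x = 0 ∨ P₂.rnDeriv (P₁ + P₂) x = 0 := by
    filter_upwards [hz] with x hx
    exact (rpow_mul_rpow_eq_zero_iff h0 h1).1 hx
  refine hs ⟨{x | P₁.rnDeriv (P₁ + P₂) x = 0},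
    Measure.measurable_rnDeriv _ _ (measurableSet_singleton 0), ?_, ?_⟩
  · have := Measure.rnDeriv_pos (ac_add_left P₁ P₂)
    rw [ae_iff] at this
    simpa using this
  · rw [← mem_ae_iff]
    filter_upwards [(ac_add_right P₁ P₂).ae_le hz', Measure.rnDeriv_pos (ac_add_right P₁ P₂)]
      with x hx hp
    exact hx.resolve_right hp.ne'

lemma isProbabilityMeasure_tiltedDist [IsProbabilityMeasure P₁] [IsProbabilityMeasure P₂]
    (h0 : 0 < t) (h1 : t < 1) (hs : ¬ P₁ ⟂ₘ P₂) : IsProbabilityMeasure (tiltedDist P₁ P₂ t) := by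
  refine ⟨?_⟩
  rw [tiltedDist, Measure.smul_apply, smul_eq_mul]
  exact ENNReal.inv_mul_cancel (geometricMixture_univ_ne_zero h0 h1 hs)
    (ne_top_of_le_ne_top ENNReal.one_ne_top (geometricMixture_univ_le_one h0 h1))

lemma tiltedDist_ac_add : tiltedDist P₁ P₂ t ≪ P₁ + P₂ :=
  (Measure.smul_absolutelyContinuous).trans (withDensity_absolutelyContinuous _ _)

lemma rnDeriv_tiltedDist [IsProbabilityMeasure P₁] [IsProbabilityMeasure P₂]
    (h0 : 0 < t) (h1 : t < 1) (hs : ¬ P₁ ⟂ₘ P₂) :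
    (tiltedDist P₁ P₂ t).rnDeriv (P₁ + P₂) =ᵐ[P₁ + P₂] fun x =>
      (geometricMixture P₁ P₂ t Set.univ)⁻¹ *
        ((P₁.rnDeriv (P₁ + P₂) x) ^ t * (P₂.rnDeriv (P₁ + P₂) x) ^ (1 - t)) := by
  have hz := geometricMixture_univ_ne_zero h0 h1 hs
  have hle : geometricMixture P₁ P₂ t Set.univ ≤ 1 := geometricMixture_univ_le_one h0 h1
  have : IsFiniteMeasure (geometricMixture P₁ P₂ t) := ⟨hle.trans_lt ENNReal.one_lt_top⟩
  filter_upwards [Measure.rnDeriv_smul_left_of_ne_top (geometricMixture P₁ P₂ t) (P₁ + P₂)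
      (ENNReal.inv_ne_top.2 hz),
    Measure.rnDeriv_withDensity (P₁ + P₂) (measurable_geometricMixture_density P₁ P₂ t)]
    with x hx hy
  rw [tiltedDist, hx, Pi.smul_apply, smul_eq_mul, ← hy]
  rfl

/-- Where both densities are positive, so is the density of the tilted distribution. -/
lemma ac_tiltedDist [IsProbabilityMeasure P₁] [IsProbabilityMeasure P₂]
    (h0 : 0 < t) (h1 : t < 1) (hs : ¬ P₁ ⟂ₘ P₂) {P : Measure A} (hP₁ : P ≪ P₁) (hP₂ : P ≪ P₂) :
    P ≪ tiltedDist P₁ P₂ t := by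
  have := isProbabilityMeasure_tiltedDist h0 h1 hs
  have hP : P ≪ P₁ + P₂ := hP₁.trans (ac_add_left P₁ P₂)
  refine absolutelyContinuous_of_rnDeriv_pos hP ?_
  filter_upwards [hP.ae_le (rnDeriv_tiltedDist h0 h1 hs),
    hP₁.ae_le (Measure.rnDeriv_pos (ac_add_left P₁ P₂)),
    hP₂.ae_le (Measure.rnDeriv_pos (ac_add_right P₁ P₂))] with x hx hp0 hq0
  rw [hx]
  refine ENNReal.mul_pos (ENNReal.inv_ne_zero.2 (ne_top_of_le_ne_top ENNReal.one_ne_top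
    (geometricMixture_univ_le_one h0 h1))) ?_
  rw [Ne, rpow_mul_rpow_eq_zero_iff h0 h1]
  exact not_or.2 ⟨hp0.ne', hq0.ne'⟩

/-- Almost surely under the tilted distribution, its density with respect to `P₁ + P₂` is positive,
and so are both factors of that density. -/
lemma tiltedDist_ac [IsProbabilityMeasure P₁] [IsProbabilityMeasure P₂]
    (h0 : 0 < t) (h1 : t < 1) (hs : ¬ P₁ ⟂ₘ P₂) :
    tiltedDist P₁ P₂ t ≪ P₁ ∧ tiltedDist P₁ P₂ t ≪ P₂ := by
  have := isProbabilityMeasure_tiltedDist h0 h1 hs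
  have hac : tiltedDist P₁ P₂ t ≪ P₁ + P₂ := tiltedDist_ac_add
  have key : ∀ᵐ x ∂(tiltedDist P₁ P₂ t),
      P₁.rnDeriv (P₁ + P₂) x ≠ 0 ∧ P₂.rnDeriv (P₁ + P₂) x ≠ 0 := by
    filter_upwards [hac.ae_le (rnDeriv_tiltedDist h0 h1 hs), Measure.rnDeriv_pos hac]
      with x hx hpos
    rw [hx] at hpos
    rw [← not_or, ← rpow_mul_rpow_eq_zero_iff h0 h1]
    exact right_ne_zero_of_mul hpos.ne'
  exact ⟨absolutelyContinuous_of_rnDeriv_pos hac (key.mono fun x hx => pos_iff_ne_zero.2 hx.1),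
    absolutelyContinuous_of_rnDeriv_pos hac (key.mono fun x hx => pos_iff_ne_zero.2 hx.2)⟩

/-- The logarithm of the density of the tilted distribution is affine in those of `P₁` and `P₂`. -/
lemma llr_tiltedDist [IsProbabilityMeasure P₁] [IsProbabilityMeasure P₂]
    (h0 : 0 < t) (h1 : t < 1) (hs : ¬ P₁ ⟂ₘ P₂) {P : Measure A} [IsProbabilityMeasure P]
    (hP₁ : P ≪ P₁) (hP₂ : P ≪ P₂) :
    (fun x => t * llr P P₁ x + (1 - t) * llr P P₂ x) =ᵐ[P] fun x =>
      llr P (tiltedDist P₁ P₂ t) x - Real.log (geometricMixture P₁ P₂ t Set.univ).toReal := by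
  have := isProbabilityMeasure_tiltedDist h0 h1 hs
  have hP : P ≪ P₁ + P₂ := hP₁.trans (ac_add_left P₁ P₂)
  have hz := geometricMixture_univ_ne_zero h0 h1 hs
  have hz' : geometricMixture P₁ P₂ t Set.univ ≠ ∞ :=
    ne_top_of_le_ne_top ENNReal.one_ne_top (geometricMixture_univ_le_one h0 h1)
  filter_upwards [hP.ae_le (rnDeriv_tiltedDist h0 h1 hs),
    hP.ae_le (Measure.rnDeriv_ne_top P₁ (P₁ + P₂)), hP.ae_le (Measure.rnDeriv_ne_top P₂ (P₁ + P₂)),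
    hP₁.ae_le (Measure.rnDeriv_pos (ac_add_left P₁ P₂)),
    hP₂.ae_le (Measure.rnDeriv_pos (ac_add_right P₁ P₂)),
    llr_eq_add hP₁ (ac_add_left P₁ P₂), llr_eq_add hP₂ (ac_add_right P₁ P₂),
    llr_eq_add (ac_tiltedDist h0 h1 hs hP₁ hP₂) tiltedDist_ac_add]
    with x hx hp hq hp0 hq0 e1 e2 e3
  have hp' := ENNReal.toReal_pos hp0.ne' hp
  have hq' := ENNReal.toReal_pos hq0.ne' hq
  have hT : llr (tiltedDist P₁ P₂ t) (P₁ + P₂) x =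
      t * llr P₁ (P₁ + P₂) x + (1 - t) * llr P₂ (P₁ + P₂) x
        - Real.log (geometricMixture P₁ P₂ t Set.univ).toReal := by
    simp only [llr, hx, ENNReal.toReal_mul, ENNReal.toReal_inv, ← ENNReal.toReal_rpow]
    rw [Real.log_mul (inv_ne_zero (ENNReal.toReal_pos hz hz').ne') (by positivity),
      Real.log_mul (by positivity) (by positivity), Real.log_inv, Real.log_rpow hp',
      Real.log_rpow hq']
    ring
  linear_combination e3 + hT - t * e1 - (1 - t) * e2

/-- A weighted sum of two relative entropies is, up to a finite constant, the relative entropy with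
respect to the tilted distribution. The constant is the scaled Rényi divergence. -/
lemma exists_add_klDiv_eq_klDiv_tiltedDist [IsProbabilityMeasure P₁] [IsProbabilityMeasure P₂]
    {a b : ℝ} (ha : 0 < a) (hb : 0 < b) (hs : ¬ P₁ ⟂ₘ P₂) :
    ∃ C : ℝ≥0∞, C ≠ ∞ ∧ ∀ P : Measure A, IsProbabilityMeasure P →
      ENNReal.ofReal a * klDiv P P₁ + ENNReal.ofReal b * klDiv P P₂ =
        ENNReal.ofReal (a + b) * klDiv P (tiltedDist P₁ P₂ (a / (a + b))) + C := by
  have hab := add_pos ha hb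
  have h0 : 0 < a / (a + b) := div_pos ha hab
  have h1 : a / (a + b) < 1 := (div_lt_one hab).2 (by linarith)
  have := isProbabilityMeasure_tiltedDist h0 h1 hs
  set T := tiltedDist P₁ P₂ (a / (a + b)) with hT
  set c := -Real.log (geometricMixture P₁ P₂ (a / (a + b)) Set.univ).toReal with hc
  have hc0 : 0 ≤ c := by
    rw [hc, Left.nonneg_neg_iff]
    exact Real.log_nonpos ENNReal.toReal_nonneg
      (ENNReal.toReal_le_of_le_ofReal zero_le_one
        (by simpa using geometricMixture_univ_le_one h0 h1))
  refine ⟨ENNReal.ofReal (a + b) * ENNReal.ofReal c,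
    ENNReal.mul_ne_top ENNReal.ofReal_ne_top ENNReal.ofReal_ne_top, fun P hP => ?_⟩
  by_cases hac : P ≪ T
  · have hP₁ := hac.trans (tiltedDist_ac h0 h1 hs).1
    have hP₂ := hac.trans (tiltedDist_ac h0 h1 hs).2
    -- both sides are the extended expectation of `a * llr P P₁ + b * llr P P₂`
    rw [klDiv_eq_extExp hP₁, klDiv_eq_extExp hP₂, klDiv_eq_extExp hac, ← extExp_const (P := P) c,
      ← (hasNonnegMean_llr hP₁).extExp_add (hasNonnegMean_llr hP₂) ha hb (ae_eq_refl _)]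
    refine (hasNonnegMean_llr hac).extExp_add
      (.of_nonneg aestronglyMeasurable_const fun _ => hc0) hab hab ?_
    filter_upwards [llr_tiltedDist h0 h1 hs hP₁ hP₂] with x hx
    rw [← mul_add, hc, ← sub_eq_add_neg, ← hx]
    field_simp
    ring
  · have hne : ¬ (P ≪ P₁ ∧ P ≪ P₂) := fun h => hac (ac_tiltedDist h0 h1 hs h.1 h.2)
    rw [klDiv_of_not_ac hac, ENNReal.mul_top (by simpa using hab), top_add]
    by_cases hP₁ : P ≪ P₁
    · rw [klDiv_of_not_ac fun h => hne ⟨hP₁, h⟩, ENNReal.mul_top (by simpa using hb), add_top]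
    · rw [klDiv_of_not_ac hP₁, ENNReal.mul_top (by simpa using ha), top_add]

/-- The Gibbs variational identity for a nonnegative loss. -/
lemma exists_klDiv_add_lintegral_eq_klDiv_tilted {Q : Measure A} [IsProbabilityMeasure Q]
    {L : A → ℝ≥0} (hL : Measurable L) {a : ℝ} (ha : 0 < a) :
    ∃ C : ℝ≥0∞, C ≠ ∞ ∧ ∀ P : Measure A, IsProbabilityMeasure P →
      ENNReal.ofReal a * klDiv P Q + ∫⁻ x, (L x : ℝ≥0∞) ∂P =
        ENNReal.ofReal a * klDiv P (Q.tilted fun x => -(L x : ℝ) / a) + C := by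
  have hle : ∀ x, Real.exp (-(L x : ℝ) / a) ≤ 1 := fun x =>
    Real.exp_le_one_iff.2 (div_nonpos_of_nonpos_of_nonneg (by simp) ha.le)
  have hexp : Integrable (fun x => Real.exp (-(L x : ℝ) / a)) Q :=
    (integrable_const 1).mono' (by fun_prop)
      (.of_forall fun x => by rw [Real.norm_of_nonneg (Real.exp_pos _).le]; exact hle x)
  have := isProbabilityMeasure_tilted hexp
  set c := -Real.log (∫ x, Real.exp (-(L x : ℝ) / a) ∂Q) with hc
  have hc0 : 0 ≤ c := by
    rw [hc, Left.nonneg_neg_iff]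
    refine Real.log_nonpos (integral_nonneg fun x => (Real.exp_pos _).le) ?_
    simpa using integral_mono hexp (integrable_const 1) hle
  refine ⟨ENNReal.ofReal a * ENNReal.ofReal c,
    ENNReal.mul_ne_top ENNReal.ofReal_ne_top ENNReal.ofReal_ne_top, fun P hP => ?_⟩
  by_cases hPQ : P ≪ Q
  · have hPT := hPQ.trans (absolutelyContinuous_tilted hexp)
    have hLm : AEStronglyMeasurable (fun x => (L x : ℝ)) P := by fun_prop
    have hlin : ∫⁻ x, (L x : ℝ≥0∞) ∂P = ENNReal.ofReal 1 * extExp P fun x => (L x : ℝ) := by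
      rw [extExp_eq_lintegral hLm fun x => (L x).2]
      simp
    -- both sides are the extended expectation of `a * llr P Q + L`
    rw [hlin, klDiv_eq_extExp hPQ, klDiv_eq_extExp hPT, ← extExp_const (P := P) c,
      ← (hasNonnegMean_llr hPQ).extExp_add (.of_nonneg hLm fun x => (L x).2) ha one_pos
        (ae_eq_refl _)]
    refine (hasNonnegMean_llr hPT).extExp_add
      (.of_nonneg aestronglyMeasurable_const fun _ => hc0) ha ha ?_
    filter_upwards [llr_tilted_right hPQ hexp] with x hx
    rw [hx, hc]
    field_simp
    ring
  · have hPT : ¬ P ≪ Q.tilted fun x => -(L x : ℝ) / a := fun h =>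
      hPQ (h.trans (tilted_absolutelyContinuous _ _))
    rw [klDiv_of_not_ac hPQ, klDiv_of_not_ac hPT, ENNReal.mul_top (by simpa using ha), top_add,
      top_add]

end Tilt

/-! ### Marginals and splitting off the last component -/

section Marginals

variable {X : ℕ → Type*} [∀ k, MeasurableSpace (X k)]

lemma marginal_self {k : ℕ} (P : Measure (Pre X k)) : marginal le_rfl P = P :=
  Measure.map_id

lemma marginal_marginal {j k l : ℕ} (hjk : j ≤ k) (hkl : k ≤ l) (P : Measure (Pre X l)) :
    marginal hjk (marginal hkl P) = marginal (hjk.trans hkl) P := by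
  unfold marginal
  rw [Measure.map_map (by fun_prop) (by fun_prop)]
  rfl

lemma isProbabilityMeasure_marginal {k l : ℕ} (h : k ≤ l) (P : Measure (Pre X l))
    [IsProbabilityMeasure P] : IsProbabilityMeasure (marginal h P) :=
  Measure.isProbabilityMeasure_map (by fun_prop)

lemma appendLast_splitLast (k : ℕ) (x : Pre X (k + 1)) : appendLast k (splitLast k x) = x := by
  ext ⟨i, hi⟩
  obtain h | rfl : i ≤ k ∨ i = k + 1 := by have := mem_Iic.1 hi; omega
  · simp [appendLast, splitLast, IicProdIoc_def, h]
  · simp [appendLast, splitLast, IicProdIoc_def, MeasurableEquiv.piSingleton]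

lemma splitLast_appendLast (k : ℕ) (p : Pre X k × X (k + 1)) :
    splitLast k (appendLast k p) = p := by
  refine Prod.ext ?_ ?_
  · ext ⟨i, hi⟩
    simp [appendLast, splitLast, IicProdIoc_def, mem_Iic.1 hi]
  · simp [appendLast, splitLast, IicProdIoc_def, MeasurableEquiv.piSingleton]

/-- `splitLast` and `appendLast` as mutually inverse measurable maps. -/
def splitLastEquiv (k : ℕ) : Pre X (k + 1) ≃ᵐ Pre X k × X (k + 1) where
  toFun := splitLast k
  invFun := appendLast k
  left_inv := appendLast_splitLast k
  right_inv := splitLast_appendLast k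
  measurable_toFun := by
    change Measurable (splitLast k)
    unfold splitLast
    fun_prop
  measurable_invFun := by
    change Measurable (appendLast k)
    unfold appendLast
    fun_prop

lemma measurable_splitLast (k : ℕ) : Measurable (splitLast (X := X) k) :=
  (splitLastEquiv k).measurable

lemma measurable_appendLast (k : ℕ) : Measurable (appendLast (X := X) k) :=
  (splitLastEquiv k).symm.measurable

lemma fst_map_splitLast (k : ℕ) (P : Measure (Pre X (k + 1))) :
    (P.map (splitLast k)).fst = marginal (Nat.le_succ k) P := by
  rw [Measure.fst, Measure.map_map measurable_fst (measurable_splitLast k)]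
  rfl

lemma map_appendLast_map_splitLast (k : ℕ) (P : Measure (Pre X (k + 1))) :
    (P.map (splitLast k)).map (appendLast k) = P :=
  (splitLastEquiv k).map_symm_map

lemma map_splitLast_map_appendLast (k : ℕ) (P : Measure (Pre X k × X (k + 1))) :
    (P.map (appendLast k)).map (splitLast k) = P :=
  (splitLastEquiv k).map_map_symm

end Marginals

/-! ### The stages of the algorithm and its output -/

section Algorithm

variable {X : ℕ → Type*} [∀ k, MeasurableSpace (X k)] {m : ℕ} {a : ℕ → ℝ}
  {R : (k : ℕ) → Measure (Pre X k)} {κ : (k : ℕ) → Kernel (Pre X k) (X (k + 1))}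

/-- The total weight `a_k + … + a_m` of the levels from `k` on. -/
noncomputable def tailWeight (m : ℕ) (a : ℕ → ℝ) (k : ℕ) : ℝ := ∑ i ∈ Icc k m, a i

lemma tailWeight_eq_add {k : ℕ} (hk : k ≤ m) :
    tailWeight m a k = a k + tailWeight m a (k + 1) := by
  unfold tailWeight
  rw [← Finset.insert_Icc_add_one_left_eq_Icc hk, sum_insert (by simp)]

lemma tailWeight_pos (ha : ∀ k ≤ m, 0 < a k) {k : ℕ} (hk : k ≤ m) : 0 < tailWeight m a k :=
  sum_pos (fun i hi => ha i (mem_Icc.1 hi).2) ⟨k, mem_Icc.2 ⟨le_rfl, hk⟩⟩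

lemma mtStage_of_lt {k : ℕ} (hk : k < m) :
    mtStage m a R k = tiltedDist (R k) (marginal (Nat.le_succ k) (mtStage m a R (k + 1)))
      (a k / (a k + tailWeight m a (k + 1))) := by
  rw [mtStage, if_pos hk, tiltOrder, ← tailWeight_eq_add hk.le, tailWeight]

lemma mtStage_self : mtStage m a R m = R m := by
  rw [mtStage, if_neg (lt_irrefl m)]

lemma isProbabilityMeasure_mtStage (ha : ∀ k ≤ m, 0 < a k)
    (hR : ∀ k ≤ m, IsProbabilityMeasure (R k)) (hdef : MTDefined m a R) {k : ℕ} (hk : k ≤ m) :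
    IsProbabilityMeasure (mtStage m a R k) := by
  induction hk using Nat.decreasingInduction with
  | self => exact mtStage_self (a := a) (R := R) ▸ hR m le_rfl
  | of_succ k hk ih =>
    have := hR k hk.le
    have := isProbabilityMeasure_marginal (Nat.le_succ k) (mtStage m a R (k + 1))
    have h0 := ha k hk.le
    have h1 := tailWeight_pos ha (Nat.succ_le_of_lt hk)
    rw [mtStage_of_lt hk]
    exact isProbabilityMeasure_tiltedDist (div_pos h0 (add_pos h0 h1))
      ((div_lt_one (add_pos h0 h1)).2 (by linarith)) (hdef k hk)

lemma map_splitLast_productOfConditionals (μ : Measure (Pre X 0)) (k : ℕ) :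
    (productOfConditionals μ κ (k + 1)).map (splitLast k) =
      productOfConditionals μ κ k ⊗ₘ κ k :=
  map_splitLast_map_appendLast k _

lemma isProbabilityMeasure_productOfConditionals (μ : Measure (Pre X 0)) [IsProbabilityMeasure μ]
    (hκ : ∀ k < m, IsMarkovKernel (κ k)) {k : ℕ} (hk : k ≤ m) :
    IsProbabilityMeasure (productOfConditionals μ κ k) := by
  induction k with
  | zero => assumption
  | succ k ih =>
    have := hκ k hk
    have := ih (Nat.le_of_succ_le hk)
    exact Measure.isProbabilityMeasure_map (measurable_appendLast k).aemeasurable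

lemma marginal_productOfConditionals (μ : Measure (Pre X 0)) [IsProbabilityMeasure μ]
    (hκ : ∀ k < m, IsMarkovKernel (κ k)) {k l : ℕ} (hkl : k ≤ l) (hl : l ≤ m) :
    marginal hkl (productOfConditionals μ κ l) = productOfConditionals μ κ k := by
  induction l, hkl using Nat.le_induction with
  | base => exact marginal_self _
  | succ l hkl ih =>
    have := hκ l hl
    have := isProbabilityMeasure_productOfConditionals μ hκ (Nat.le_of_succ_le hl)
    rw [← marginal_marginal hkl (Nat.le_succ l), ← fst_map_splitLast,
      map_splitLast_productOfConditionals, Measure.fst_compProd, ih (Nat.le_of_succ_le hl)]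

/-- `M` is the sequence of the marginals of its last member `M m`, and these are probability
measures. Indexing the marginals by all of `ℕ` avoids carrying the proof of `k ≤ m` in sums; the
members beyond `m` are arbitrary. -/
structure IsMarginalSeq (m : ℕ) (M : (k : ℕ) → Measure (Pre X k)) : Prop where
  isProbabilityMeasure : ∀ k ≤ m, IsProbabilityMeasure (M k)
  marginal_succ : ∀ k < m, marginal (Nat.le_succ k) (M (k + 1)) = M k

/-- The relative entropy of the law of the component `k + 1` given the preceding ones with respect
to the kernel `κ k`, averaged over `M`. -/
noncomputable def condEntropy (κ : (k : ℕ) → Kernel (Pre X k) (X (k + 1)))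
    (M : (k : ℕ) → Measure (Pre X k)) (k : ℕ) : ℝ≥0∞ :=
  klDiv ((M (k + 1)).map (splitLast k)) (M k ⊗ₘ κ k)

lemma IsMarginalSeq.klDiv_succ {M : (k : ℕ) → Measure (Pre X k)} (hM : IsMarginalSeq m M) {k : ℕ}
    (hk : k < m) [IsMarkovKernel (κ k)] (S : Measure (Pre X (k + 1))) [IsProbabilityMeasure S]
    (hS : (S.map (splitLast k)).IsCondKernel (κ k)) :
    klDiv (M (k + 1)) S = klDiv (M k) (marginal (Nat.le_succ k) S) + condEntropy κ M k := by
  have := hM.isProbabilityMeasure (k + 1) hk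
  have := isProbabilityMeasure_marginal (Nat.le_succ k) S
  have : IsProbabilityMeasure ((M (k + 1)).map (splitLast k)) :=
    Measure.isProbabilityMeasure_map (measurable_splitLast k).aemeasurable
  have key := klDiv_compProd_eq_fst_add ((M (k + 1)).map (splitLast k))
    (marginal (Nat.le_succ k) S) (κ k)
  rw [fst_map_splitLast, hM.marginal_succ k hk, ← fst_map_splitLast, hS.disintegrate,
    fst_map_splitLast] at key
  rw [condEntropy, ← key]
  exact (klDiv_map_measurableEquiv _ _ (splitLastEquiv k)).symm

/-- The entropies of the levels from `j` on collapse to a single relative entropy with respect to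
the stage `S^(j)`, plus the weighted conditional relative entropies, plus a finite constant. -/
lemma exists_sum_klDiv_eq (ha : ∀ k ≤ m, 0 < a k) (hR : ∀ k ≤ m, IsProbabilityMeasure (R k))
    (hdef : MTDefined m a R)
    (hκ : ∀ k < m, IsMarkovKernel (κ k) ∧
      ((mtStage m a R (k + 1)).map (splitLast k)).IsCondKernel (κ k)) {j : ℕ} (hj : j ≤ m) :
    ∃ C : ℝ≥0∞, C ≠ ∞ ∧ ∀ M : (k : ℕ) → Measure (Pre X k), IsMarginalSeq m M →
      ∑ k ∈ Ico j (m + 1), ENNReal.ofReal (a k) * klDiv (M k) (R k) =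
        ENNReal.ofReal (tailWeight m a j) * klDiv (M j) (mtStage m a R j) +
          ∑ k ∈ Ico j m, ENNReal.ofReal (tailWeight m a (k + 1)) * condEntropy κ M k + C := by
  induction hj using Nat.decreasingInduction with
  | self => exact ⟨0, ENNReal.zero_ne_top, fun M _ => by simp [tailWeight, mtStage_self]⟩
  | of_succ j hj ih =>
    obtain ⟨C, hC, h⟩ := ih
    have := hR j hj.le
    have := isProbabilityMeasure_mtStage ha hR hdef (Nat.succ_le_of_lt hj)
    have := isProbabilityMeasure_marginal (Nat.le_succ j) (mtStage m a R (j + 1))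
    obtain ⟨C', hC', h'⟩ := exists_add_klDiv_eq_klDiv_tiltedDist (ha j hj.le)
      (tailWeight_pos ha (Nat.succ_le_of_lt hj)) (hdef j hj)
    refine ⟨C' + C, ENNReal.add_ne_top.2 ⟨hC', hC⟩, fun M hM => ?_⟩
    have := (hκ j hj).1
    rw [sum_eq_sum_Ico_succ_bot (by omega), sum_eq_sum_Ico_succ_bot hj, h M hM,
      hM.klDiv_succ hj _ (hκ j hj).2, mtStage_of_lt hj, tailWeight_eq_add hj.le, mul_add]
    have e := h' (M j) (hM.isProbabilityMeasure j hj.le)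
    -- the chain rule has split the entropy at level `j + 1`; its marginal part joins level `j`
    calc _ = (ENNReal.ofReal (a j) * klDiv (M j) (R j) + ENNReal.ofReal (tailWeight m a (j + 1)) *
          klDiv (M j) (marginal (Nat.le_succ j) (mtStage m a R (j + 1)))) +
        (ENNReal.ofReal (tailWeight m a (j + 1)) * condEntropy κ M j +
          ∑ k ∈ Ico (j + 1) m, ENNReal.ofReal (tailWeight m a (k + 1)) * condEntropy κ M k +
            C) := by
          ring
      _ = _ := by
          rw [e]
          ring

/-- The marginals of `P`, continued by `0` beyond `m`. -/
noncomputable def marginalSeq (P : Measure (Pre X m)) (k : ℕ) : Measure (Pre X k) :=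
  if h : k ≤ m then marginal h P else 0

lemma isMarginalSeq_marginalSeq (P : Measure (Pre X m)) [IsProbabilityMeasure P] :
    IsMarginalSeq m (marginalSeq P) := by
  refine ⟨fun k hk => ?_, fun k hk => ?_⟩
  · rw [marginalSeq, dif_pos hk]
    exact isProbabilityMeasure_marginal hk P
  · rw [marginalSeq, marginalSeq, dif_pos hk.le, dif_pos (Nat.succ_le_of_lt hk), marginal_marginal]

lemma entropySum_eq_sum_Ico (P : Measure (Pre X m)) :
    entropySum m a R P =
      ∑ k ∈ Ico 0 (m + 1), ENNReal.ofReal (a k) * klDiv (marginalSeq P k) (R k) := by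
  rw [entropySum, ← Finset.range_eq_Ico, ← Fin.sum_univ_eq_sum_range
    (fun k => ENNReal.ofReal (a k) * klDiv (marginalSeq P k) (R k))]
  refine Finset.sum_congr rfl fun k _ => ?_
  rw [marginalSeq, dif_pos (Nat.le_of_lt_succ k.isLt)]

/-- A marginal sequence with vanishing relative entropies is the one built from the kernels. -/
lemma eq_productOfConditionals {M : (k : ℕ) → Measure (Pre X k)} (hM : IsMarginalSeq m M)
    (μ : Measure (Pre X 0)) [IsProbabilityMeasure μ] (hκ : ∀ k < m, IsMarkovKernel (κ k))
    (h0 : klDiv (M 0) μ = 0) (hc : ∀ k < m, condEntropy κ M k = 0) {k : ℕ} (hk : k ≤ m) :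
    M k = productOfConditionals μ κ k := by
  induction k with
  | zero =>
    have := hM.isProbabilityMeasure 0 hk
    exact (klDiv_eq_zero_iff (ν := μ)).1 h0
  | succ k ih =>
    have := hκ k hk
    have := hM.isProbabilityMeasure k (Nat.le_of_succ_le hk)
    have := hM.isProbabilityMeasure (k + 1) hk
    have : IsProbabilityMeasure ((M (k + 1)).map (splitLast k)) :=
      Measure.isProbabilityMeasure_map (measurable_splitLast k).aemeasurable
    have e : (M (k + 1)).map (splitLast k) = M k ⊗ₘ κ k := klDiv_eq_zero_iff.1 (hc k hk)
    rw [← map_appendLast_map_splitLast k (M (k + 1)), e, ih (Nat.le_of_succ_le hk)]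
    rfl

/-- The objective exceeds its finite value at an output by a quantity that vanishes only there. -/
lemma IsMTOutput.isUniqueMinimizer_entropySum (ha : ∀ k ≤ m, 0 < a k)
    (hR : ∀ k ≤ m, IsProbabilityMeasure (R k)) (hdef : MTDefined m a R)
    {P : Measure (Pre X m)} (hP : IsMTOutput m a R P) :
    IsUniqueMinimizer (entropySum m a R) P := by
  obtain ⟨κ, hκ, rfl⟩ := hP
  have hκ' : ∀ k < m, IsMarkovKernel (κ k) := fun k hk => (hκ k hk).1
  have := isProbabilityMeasure_mtStage ha hR hdef (Nat.zero_le m)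
  have hprob := isProbabilityMeasure_productOfConditionals (mtStage m a R 0) hκ' le_rfl
  obtain ⟨C, hC, h⟩ := exists_sum_klDiv_eq ha hR hdef hκ (Nat.zero_le m)
  have hval : entropySum m a R (productOfConditionals (mtStage m a R 0) κ m) = C := by
    have hseq : ∀ k ≤ m, marginalSeq (productOfConditionals (mtStage m a R 0) κ m) k =
        productOfConditionals (mtStage m a R 0) κ k := fun k hk => by
      rw [marginalSeq, dif_pos hk, marginal_productOfConditionals _ hκ' hk le_rfl]
    rw [entropySum_eq_sum_Ico, h _ (isMarginalSeq_marginalSeq _), hseq 0 (Nat.zero_le m),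
      Finset.sum_eq_zero, productOfConditionals, klDiv_self, mul_zero, zero_add, zero_add]
    intro k hk
    have hk' := (mem_Ico.1 hk).2
    have := hκ' k hk'
    have := isProbabilityMeasure_productOfConditionals (mtStage m a R 0) hκ' hk'.le
    rw [condEntropy, hseq (k + 1) hk', hseq k hk'.le, map_splitLast_productOfConditionals,
      klDiv_self, mul_zero]
  refine ⟨hprob, fun P' hP' hne => ?_⟩
  have hM := isMarginalSeq_marginalSeq P'
  rw [hval, entropySum_eq_sum_Ico, h _ hM, add_comm]
  refine ENNReal.lt_add_right hC fun hzero => hne ?_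
  obtain ⟨h1, h2⟩ := add_eq_zero.1 hzero
  have e := eq_productOfConditionals hM (mtStage m a R 0) hκ'
    ((mul_eq_zero.1 h1).resolve_left (by simpa using tailWeight_pos ha (Nat.zero_le m)))
    (fun k hk => (mul_eq_zero.1
      (sum_eq_zero_iff.1 h2 k (mem_Ico.2 ⟨Nat.zero_le k, hk⟩))).resolve_left
        (by simpa using tailWeight_pos ha (Nat.succ_le_of_lt hk))) le_rfl
  rwa [marginalSeq, dif_pos le_rfl, marginal_self] at e

/-- On standard Borel components the conditional distributions of the stages exist; the kernels
with index at least `m` are irrelevant. -/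
lemma exists_isMTOutput (ha : ∀ k ≤ m, 0 < a k) (hR : ∀ k ≤ m, IsProbabilityMeasure (R k))
    (hdef : MTDefined m a R) (hX : ∀ k, 1 ≤ k → k ≤ m → StandardBorelSpace (X k)) :
    ∃ P : Measure (Pre X m), IsMTOutput m a R P := by
  have key : ∀ k, ∃ κ : Kernel (Pre X k) (X (k + 1)), k < m → IsMarkovKernel κ ∧
      ((mtStage m a R (k + 1)).map (splitLast k)).IsCondKernel κ := by
    intro k
    by_cases hk : k < m
    · have := hX (k + 1) (Nat.succ_pos k) hk
      have := isProbabilityMeasure_mtStage ha hR hdef (Nat.succ_le_of_lt hk)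
      have : Nonempty (X (k + 1)) :=
        (nonempty_of_isProbabilityMeasure (mtStage m a R (k + 1))).map (fun x => (splitLast k x).2)
      exact ⟨((mtStage m a R (k + 1)).map (splitLast k)).condKernel,
        fun _ => ⟨inferInstance, inferInstance⟩⟩
    · exact ⟨0, fun h => absurd h hk⟩
  choose κ hκ using key
  exact ⟨_, κ, hκ, rfl⟩

end Algorithm

/-! ### The Gibbs posterior -/

section Gibbs

variable {X : ℕ → Type*} [∀ k, MeasurableSpace (X k)] {Z : Type*} {m n : ℕ} {a : ℕ → ℝ}

lemma measurable_empiricalRisk {loss : Pre X m → Z → ℝ≥0} (s : Fin n → Z)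
    (hloss : ∀ z, Measurable fun w => loss w z) : Measurable (empiricalRisk loss s) := by
  unfold empiricalRisk
  exact (Finset.measurable_sum _ fun i _ => hloss (s i)).const_mul _

lemma isProbabilityMeasure_gibbsInput {loss : Pre X m → Z → ℝ≥0} (s : Fin n → Z)
    {Q : (k : ℕ) → Measure (Pre X k)} (ha : 0 < a m)
    (hloss : ∀ z, Measurable fun w => loss w z) (hQ : ∀ k ≤ m, IsProbabilityMeasure (Q k))
    (k : ℕ) (hk : k ≤ m) : IsProbabilityMeasure (gibbsInput m a loss s Q k) := by
  obtain rfl | hne := eq_or_ne k m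
  · have := hQ k le_rfl
    have hm := measurable_empiricalRisk s hloss
    rw [gibbsInput, Function.update_self]
    refine isProbabilityMeasure_tilted ((integrable_const (1 : ℝ)).mono' (by fun_prop)
      (.of_forall fun x => ?_))
    rw [Real.norm_of_nonneg (Real.exp_pos _).le]
    exact Real.exp_le_one_iff.2 (div_nonpos_of_nonpos_of_nonneg (by simp) ha.le)
  · rw [gibbsInput, Function.update_of_ne hne]
    exact hQ k hk

/-- The expected loss is absorbed into the entropy term of the last level. -/
lemma exists_regularizedRisk_eq {loss : Pre X m → Z → ℝ≥0} (s : Fin n → Z)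
    {Q : (k : ℕ) → Measure (Pre X k)} (ha : 0 < a m)
    (hloss : ∀ z, Measurable fun w => loss w z) [IsProbabilityMeasure (Q m)] :
    ∃ C : ℝ≥0∞, C ≠ ∞ ∧ ∀ P : Measure (Pre X m), IsProbabilityMeasure P →
      regularizedRisk m a loss s Q P = entropySum m a (gibbsInput m a loss s Q) P + C := by
  obtain ⟨C, hC, h⟩ := exists_klDiv_add_lintegral_eq_klDiv_tilted (Q := Q m)
    (measurable_empiricalRisk s hloss) ha
  refine ⟨C, hC, fun P hP => ?_⟩
  have hP' : marginalSeq P m = P := by rw [marginalSeq, dif_pos le_rfl, marginal_self]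
  have hlow : ∀ k ∈ range m, ENNReal.ofReal (a k) * klDiv (marginalSeq P k) (Q k) =
      ENNReal.ofReal (a k) * klDiv (marginalSeq P k) (gibbsInput m a loss s Q k) := fun k hk => by
    rw [gibbsInput, Function.update_of_ne (mem_range.1 hk).ne]
  rw [regularizedRisk, entropySum_eq_sum_Ico, entropySum_eq_sum_Ico, ← Finset.range_eq_Ico,
    sum_range_succ, sum_range_succ, sum_congr rfl hlow, hP', add_assoc, gibbsInput,
    Function.update_self, ← h P hP]
  ring

end Gibbs

end MarginalizeTilt

theorem mainTheorem3 {X : ℕ → Type*} [∀ k, MeasurableSpace (X k)] {Z : Type*}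
    (m : ℕ) (a : ℕ → ℝ) (ha : ∀ k ≤ m, 0 < a k) :
    (∀ R : (k : ℕ) → Measure (Pre X k),
      (∀ k ≤ m, IsProbabilityMeasure (R k)) → MTDefined m a R →
        ((∀ k, 1 ≤ k → k ≤ m → StandardBorelSpace (X k)) →
          ∃ P : Measure (Pre X m), IsMTOutput m a R P) ∧
        (∀ P : Measure (Pre X m), IsMTOutput m a R P →
          IsUniqueMinimizer (entropySum m a R) P)) ∧
    (∀ (n : ℕ) (loss : Pre X m → Z → ℝ≥0) (s : Fin n → Z)
      (Q : (k : ℕ) → Measure (Pre X k)),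
      (∀ z, Measurable fun w => loss w z) →
      (∀ k ≤ m, IsProbabilityMeasure (Q k)) → MTDefined m a (gibbsInput m a loss s Q) →
        ∀ P : Measure (Pre X m), IsMTOutput m a (gibbsInput m a loss s Q) P →
          IsUniqueMinimizer (regularizedRisk m a loss s Q) P) := by
  refine ⟨fun R hR hdef => ⟨exists_isMTOutput ha hR hdef, fun P hP =>
      hP.isUniqueMinimizer_entropySum ha hR hdef⟩, fun n loss s Q hloss hQ hdef P hP => ?_⟩
  have := hQ m le_rfl
  obtain ⟨h1, h2⟩ := hP.isUniqueMinimizer_entropySum ha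
    (isProbabilityMeasure_gibbsInput s (ha m le_rfl) hloss hQ) hdef
  obtain ⟨C, hC, h⟩ := exists_regularizedRisk_eq s (ha m le_rfl) hloss (Q := Q)
  refine ⟨h1, fun P' hP' hne => ?_⟩
  rw [h P h1, h P' hP']
  exact ENNReal.add_lt_add_right hC (h2 P' hP' hne)
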